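/- Let $\mathbb{A}$ be the Rado atoms, i.e. the Rado graph (the countable Fraïssé limit of the class of finite undirected graphs), let $\operatorname{Aut}(\mathbb{A})$ be its automorphism group, and let $\mathbb{F}$ be an arbitrary field. Terminology. Let $V$ be an $\mathbb{F}$-vector space on which $\operatorname{Aut}(\mathbb{A})$ acts by linear maps. A vector $v$ is *finitely supported* if there is a finite $S\subset\mathbb{A}$ such that $\pi(v)=v$ for every automorphism $\pi$ with $\pi(a)=a$ for all $a\in S$. A subset $X \subseteq V$ is *orbit-finite* if it is closed under $\operatorname{Aut}(\mathbb{A})$, all its elements are finitely supported, and it has finitely many orbits. The space $V$ is *orbit-finitely spanned* if all its vectors are finitely supported and $V$ is spanned by some orbit-finite subset. For a second such space $W$, $V\to_{\mathrm{fs}} W$ denotes the space of all linear maps $f:V\to W$ for which there is a finite $S\subset\mathbb{A}$ such that $\pi(f(v))=f(\pi(v))$ for all $v \in V$ and all automorphisms $\pi$ fixing $S$ pointwise; automorphisms act on it by $f\mapsto \pi\circ f\circ\pi^{-1}$. The field $\mathbb{F}$ itself carries the trivial action, $\operatorname{Lin}_{\mathbb F}\mathbb{A}$ is the space of finite formal $\mathbb{F}$-linear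 combinations of atoms, and $\mathbb{A}\to_{\mathrm{fs}}\mathbb{F}$ is the space of finitely supported functions $\mathbb{A}\to\mathbb{F}$, where $(\pi f)(a)=f(\pi^{-1}(a))$. The atoms have the *dual space property* over $\mathbb{F}$ if $V\to_{\mathrm{fs}}\mathbb{F}$ is orbit-finitely spanned for every orbit-finitely spanned $V$ over $\mathbb{F}$. For a finite set $S\subset\mathbb{A}$, let $f_S:\mathbb{A}\to\mathbb{F}$ be the function with $f_S(a)=1$ if $a$ is a neighbour of all atoms in $S$, and $f_S(a)=0$ otherwise. Then: 1. The space $\operatorname{Lin}_{\mathbb F}\mathbb{A}\to_{\mathrm{fs}}\mathbb{F}$ of finitely supported linear functionals is not orbit-finitely spanned. 2. $\operatorname{Lin}_{\mathbb F}\mathbb{A}$ is orbit-finitely spanned; hence the Rado atoms do not have the dual space property over $\mathbb{F}$. 3. Restricting functionals to $\mathbb{A}$ is an equivariant linear bijection from $\operatorname{Lin}_{\mathbb F}\mathbb{A}\to_{\mathrm{fs}}\mathbb{F}$ to $\mathbb{A}\to_{\mathrm{fs}}\mathbb{F}$, and the latter space is not orbit-finitely spanned. 4. The functions $f_S$, for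 $S$ ranging over the finite subsets of $\mathbb{A}$, span an equivariant subspace of $\mathbb{A}\to_{\mathrm{fs}}\mathbb{F}$. The set of all $f_S$ is not orbit-finite, and their span is not orbit-finitely spanned. -/

import Mathlib

open FirstOrder

universe u v

namespace Atoms

section General

/-! Throughout this section `Γ` is the automorphism group of an atom structure with underlying
set `𝔸`, acting on `𝔸` in the usual way.  A vector space equipped with an action of the
automorphisms for which addition and scalar multiplication are equivariant is the same thing as a
representation of `Γ`. -/

variable {F Γ V W : Type*} [Field F] [Group Γ] [AddCommMonoid V] [Module F V]
  [AddCommMonoid W] [Module F W]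

/-- `v` has a finite support: some finite set `S` of atoms such that every automorphism that
fixes `S` pointwise fixes `v`. -/
def IsFinitelySupported (𝔸 : Type*) [MulAction Γ 𝔸] (ρ : Representation F Γ V) (v : V) : Prop :=
  ∃ S : Finset 𝔸, ∀ π : Γ, (∀ a ∈ S, π • a = a) → ρ π v = v

/-- An equivariant subset `X` of `V` that is an orbit-finite set: every element has a finite
support, and there are only finitely many orbits. -/
structure IsOrbitFinite (𝔸 : Type*) [MulAction Γ 𝔸] (ρ : Representation F Γ V) (X : Set V) :
    Prop where
  equivariant : ∀ π : Γ, ∀ x ∈ X, ρ π x ∈ X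
  supported : ∀ x ∈ X, IsFinitelySupported 𝔸 ρ x
  finite_orbits : {O : Set V | ∃ x ∈ X, O = Set.range fun π : Γ => ρ π x}.Finite

/-- Orbit-finitely spanned vector spaces. -/
structure IsOrbitFinitelySpanned (𝔸 : Type*) [MulAction Γ 𝔸] (ρ : Representation F Γ V) :
    Prop where
  supported : ∀ v : V, IsFinitelySupported 𝔸 ρ v
  spanned : ∃ X : Set V, IsOrbitFinite 𝔸 ρ X ∧ Submodule.span F X = ⊤

/-- The equivariant subspace of all finitely supported vectors. -/
def finitelySupportedPart (𝔸 : Type*) [MulAction Γ 𝔸] (ρ : Representation F Γ V) :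
    Subrepresentation ρ where
  toSubmodule :=
    { carrier := {v | IsFinitelySupported 𝔸 ρ v}
      zero_mem' := ⟨∅, fun π _ => map_zero _⟩
      add_mem' := by
        classical
        rintro v w ⟨S, hS⟩ ⟨T, hT⟩
        refine ⟨S ∪ T, fun π h => ?_⟩
        rw [map_add, hS π fun a ha => h a (Finset.mem_union_left _ ha),
          hT π fun a ha => h a (Finset.mem_union_right _ ha)]
      smul_mem' := by
        rintro c v ⟨S, hS⟩
        exact ⟨S, fun π h => by rw [map_smul, hS π h]⟩ }
  apply_mem_toSubmodule := by
    classical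
    rintro g v ⟨S, hS⟩
    refine ⟨S.image (g • ·), fun π h => ?_⟩
    have h1 : ρ (g⁻¹ * π * g) v = v := hS _ fun a ha => by
      have h2 := h (g • a) (Finset.mem_image_of_mem _ ha)
      rw [mul_smul, mul_smul, h2, inv_smul_smul]
    have h3 : ρ π (ρ g v) = ρ g (ρ (g⁻¹ * π * g) v) := by
      rw [← Module.End.mul_apply, ← Module.End.mul_apply, ← map_mul, ← map_mul]
      group
    rw [h3, h1]

/-- The finitely supported function space: the finitely supported elements of the space of all
linear maps `V → W`, on which automorphisms act by conjugation. -/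
def fsHom (𝔸 : Type*) [MulAction Γ 𝔸] (ρV : Representation F Γ V) (ρW : Representation F Γ W) :
    Subrepresentation (Representation.linHom ρV ρW) :=
  finitelySupportedPart 𝔸 (Representation.linHom ρV ρW)

/-- The finite support condition on a linear map `f`, spelled out: for some finite set `S` of atoms,
`f` commutes with all automorphisms that fix `S` pointwise. -/
theorem mem_fsHom (𝔸 : Type*) [MulAction Γ 𝔸] (ρV : Representation F Γ V)
    (ρW : Representation F Γ W) (f : V →ₗ[F] W) :
    f ∈ (fsHom 𝔸 ρV ρW).toSubmodule ↔
      ∃ S : Finset 𝔸, ∀ π : Γ, (∀ a ∈ S, π • a = a) → ∀ v : V, ρW π (f v) = f (ρV π v) := by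
  refine exists_congr fun S => forall_congr' fun π => imp_congr_right fun _ => ?_
  rw [LinearMap.ext_iff]
  constructor
  · intro h v
    simpa using h (ρV π v)
  · intro h v
    simpa using h (ρV π⁻¹ v)

/-- The space of finitely supported linear functionals on `V`: the finitely supported function space
from `V` to the field, on which automorphisms act trivially. -/
abbrev fsDual (𝔸 : Type*) [MulAction Γ 𝔸] (ρ : Representation F Γ V) :
    Subrepresentation (Representation.linHom ρ (Representation.trivial F Γ F)) :=
  fsHom 𝔸 ρ (Representation.trivial F Γ F)

/-- The space `Lin_F 𝔸` of finite formal linear combinations of atoms, with its action of the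
automorphisms. -/
noncomputable def linAtoms (F Γ 𝔸 : Type*) [Field F] [Group Γ] [MulAction Γ 𝔸] :
    Representation F Γ (𝔸 →₀ F) where
  toFun π := Finsupp.lmapDomain F F (π • ·)
  map_one' := by ext; simp
  map_mul' π σ := by ext; simp [mul_smul]

/-- The space of all functions `𝔸 → F`, with the action `(π f)(a) = f (π⁻¹ a)`. -/
def funAtoms (F Γ 𝔸 : Type*) [Field F] [Group Γ] [MulAction Γ 𝔸] :
    Representation F Γ (𝔸 → F) where
  toFun π := LinearMap.funLeft F F (π⁻¹ • ·)
  map_one' := by ext; simp [LinearMap.funLeft_apply]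
  map_mul' π σ := by ext; simp [LinearMap.funLeft_apply, mul_smul]

/-- The space of finitely supported functions `𝔸 → F`. -/
abbrev fsFun (F Γ 𝔸 : Type*) [Field F] [Group Γ] [MulAction Γ 𝔸] :
    Subrepresentation (funAtoms F Γ 𝔸) :=
  finitelySupportedPart 𝔸 (funAtoms F Γ 𝔸)

end General

/-- The dual space property over the field `F` of an atom structure with underlying set `𝔸` and
automorphism group `Γ`: the finitely supported dual of every orbit-finitely spanned vector space is
orbit-finitely spanned. -/
def DualSpaceProperty (F : Type v) (Γ 𝔸 : Type u) [Field F] [Group Γ] [MulAction Γ 𝔸] : Prop :=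
  ∀ (V : Type (max u v)) [AddCommGroup V] [Module F V] (ρ : Representation F Γ V),
    IsOrbitFinitelySpanned 𝔸 ρ → IsOrbitFinitelySpanned 𝔸 (fsDual 𝔸 ρ).toRepresentation

section Rado

/-- `G` is (an isomorphic copy of) the Rado graph: the Fraïssé limit of the class of finite
undirected graphs. -/
def IsRadoGraph {𝔸 : Type u} [Countable 𝔸] (G : SimpleGraph 𝔸) : Prop :=
  letI := G.structure
  Language.IsFraisseLimit
    {S : CategoryTheory.Bundled.{u} Language.graph.Structure |
      Finite S ∧ S ⊨ Language.Theory.simpleGraph} 𝔸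

section Explicit

open Language

/-- An explicit description of the Rado graph: the vertices are the natural numbers, with an edge
between `n < m` if the `n`-th bit of `m` is `1`.  It shows that `IsRadoGraph` is satisfiable. -/
def bitGraph : SimpleGraph ℕ where
  Adj n m := (n < m ∧ m.testBit n) ∨ (m < n ∧ n.testBit m)
  symm := ⟨fun _ _ h => h.symm⟩
  loopless := ⟨fun n h => by simp at h⟩

theorem bitGraph_extension (S T : Finset ℕ) (h : Disjoint S T) :
    ∃ m, (∀ s ∈ S, s < m ∧ bitGraph.Adj m s) ∧ ∀ t ∈ T, t < m ∧ ¬ bitGraph.Adj m t := by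
  classical
  set N := (S ∪ T).sup id + 1 with hNdef
  have hN : ∀ s ∈ S ∪ T, s < N := fun s hs => Nat.lt_succ_of_le (Finset.le_sup (f := id) hs)
  set m := Finset.equivBitIndices.symm (insert N S) with hm
  have hb : ∀ i, m.testBit i ↔ i ∈ insert N S := by
    intro i
    rw [← Nat.mem_bitIndices, ← List.mem_toFinset]
    change i ∈ Finset.equivBitIndices m ↔ _
    rw [hm, Equiv.apply_symm_apply]
  have hl : ∀ s ∈ S ∪ T, s < m := fun s hs => (hN s hs).trans <|
    (Nat.lt_two_pow_self).trans_le (Nat.ge_two_pow_of_testBit ((hb N).2 (by simp)))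
  refine ⟨m, fun s hs => ?_, fun t ht => ?_⟩
  · have := hl s (by simp [hs])
    exact ⟨this, Or.inr ⟨this, (hb s).2 (by simp [hs])⟩⟩
  · have h1 := hl t (by simp [ht])
    refine ⟨h1, ?_⟩
    rintro (⟨h2, -⟩ | ⟨-, h2⟩)
    · omega
    · have := (hb t).1 h2
      rcases Finset.mem_insert.1 this with h3 | h3
      · have := hN t (by simp [ht]); omega
      · exact Finset.disjoint_left.1 h h3 ht

theorem bitGraph_isExtensionPair {M : Type*} (H : SimpleGraph M) :
    letI := H.structure
    letI := bitGraph.structure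
    Language.graph.IsExtensionPair M ℕ := by
  classical
  let := H.structure
  let := bitGraph.structure
  change Language.graph.IsExtensionPair M ℕ
  rw [isExtensionPair_iff_exists_embedding_closure_singleton_sup]
  intro S hS f m
  have hfin : Finite S := (S.fg_iff_structure_fg.1 hS).finite
  have hf : ∀ x y : S, bitGraph.Adj (f x) (f y) ↔ H.Adj x.1 y.1 := by
    intro x y
    have := f.map_rel (Language.adj) ![x, y]
    exact this
  have hmem : ∀ x, x ∈ (Substructure.closure Language.graph {m} ⊔ S : Language.graph.Substructure M) ↔
      x = m ∨ x ∈ S := by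
    intro x
    have : (Substructure.closure Language.graph {m} ⊔ S : Language.graph.Substructure M)
      = Substructure.closure Language.graph (insert m (S : Set M)) := by
      rw [Substructure.closure_insert, Substructure.closure_eq]
    rw [this, ← SetLike.mem_coe, Substructure.closure_eq_of_isRelational]
    simp
  have key : ∃ g : M → ℕ, (∀ x : S, g x = f x) ∧ ∀ x y, (x = m ∨ x ∈ S) → (y = m ∨ y ∈ S) →
      (g x = g y → x = y) ∧ (bitGraph.Adj (g x) (g y) ↔ H.Adj x y) := by
    by_cases hmS : m ∈ S
    · refine ⟨fun x => if h : x ∈ S then f ⟨x, h⟩ else 0, fun x => by simp, ?_⟩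
      intro x y hx hy
      have hx : x ∈ S := by rcases hx with rfl | h <;> assumption
      have hy : y ∈ S := by rcases hy with rfl | h <;> assumption
      simp only [hx, hy, dif_pos]
      exact ⟨fun h => by simpa using f.injective h, hf ⟨x, hx⟩ ⟨y, hy⟩⟩
    · have : Fintype S := Fintype.ofFinite S
      obtain ⟨k, hk1, hk2⟩ := bitGraph_extension ((Finset.univ.filter fun x : S => H.Adj m x).image f)
        ((Finset.univ.filter fun x : S => ¬ H.Adj m x).image f) (by
          rw [Finset.disjoint_image f.injective]
          exact Finset.disjoint_filter_filter_not _ _ _)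
      have hk : ∀ x : S, f x < k ∧ (bitGraph.Adj k (f x) ↔ H.Adj m x) := by
        intro x
        by_cases h : H.Adj m x
        · have := hk1 (f x) (Finset.mem_image_of_mem _ (by simp [h]))
          exact ⟨this.1, by simp [h, this.2]⟩
        · have := hk2 (f x) (Finset.mem_image_of_mem _ (by simp [h]))
          exact ⟨this.1, by simp [h, this.2]⟩
      refine ⟨fun x => if h : x ∈ S then f ⟨x, h⟩ else k, fun x => by simp, ?_⟩
      rintro x y (rfl | hx) (rfl | hy)
      · simp [hmS]
      · have := hk ⟨y, hy⟩
        simp only [hmS, hy, dif_pos, dif_neg, not_false_eq_true]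
        exact ⟨fun h => by omega, this.2⟩
      · have := hk ⟨x, hx⟩
        simp only [hmS, hx, dif_pos, dif_neg, not_false_eq_true]
        exact ⟨fun h => by omega, by rw [bitGraph.adj_comm, H.adj_comm]; exact this.2⟩
      · simp only [hx, hy, dif_pos]
        exact ⟨fun h => by simpa using f.injective h, hf ⟨x, hx⟩ ⟨y, hy⟩⟩
  obtain ⟨g, hg1, hg2⟩ := key
  refine ⟨⟨⟨fun x => g x.1, ?_⟩, ?_, ?_⟩, ?_⟩
  · intro x y h
    exact Subtype.ext ((hg2 _ _ ((hmem _).1 x.2) ((hmem _).1 y.2)).1 h)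
  · intro n F; exact isEmptyElim F
  · intro n r x
    match n, r with
    | 2, .adj => exact (hg2 _ _ ((hmem _).1 (x 0).2) ((hmem _).1 (x 1).2)).2
  · ext x
    exact (hg1 x).symm

theorem isRadoGraph_bitGraph : IsRadoGraph bitGraph := by
  let := bitGraph.structure
  refine ⟨(isUltrahomogeneous_iff_IsExtensionPair Structure.cg_of_countable).2 (bitGraph_isExtensionPair bitGraph), ?_⟩
  ext N
  refine ⟨fun ⟨hF, h⟩ => ⟨hF.finite, ?_⟩, fun ⟨hF, h⟩ => ⟨Structure.FG.of_finite, ?_⟩⟩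
  · obtain ⟨e⟩ := h
    rw [Theory.simpleGraph_model_iff]
    have he : ∀ x y : N, Structure.RelMap Language.adj ![x, y] ↔ bitGraph.Adj (e x) (e y) := by
      intro x y
      exact (e.map_rel Language.adj ![x, y]).symm
    exact ⟨⟨fun x hx => bitGraph.loopless.irrefl _ ((he _ _).1 hx)⟩,
      ⟨fun x y hx => (he _ _).2 ((he _ _).1 hx).symm⟩⟩
  · have h := bitGraph_isExtensionPair (simpleGraphOfStructure N)
    rw [structure_simpleGraphOfStructure] at h
    have : IsEmpty (Language.graph.Relations 0) := ⟨fun r => nomatch r⟩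
    obtain ⟨f, _⟩ := embedding_from_cg Structure.cg_of_countable default h
    exact ⟨f⟩

end Explicit

variable (F : Type*) [Field F] {𝔸 : Type*} (G : SimpleGraph 𝔸)

/-- The function `f_S : 𝔸 → F`, the indicator function of the set of common neighbours of `S`. -/
noncomputable def commonNeighbourFun (S : Finset 𝔸) : 𝔸 → F :=
  Set.indicator {a | ∀ s ∈ S, G.Adj a s} fun _ => 1

theorem funAtoms_commonNeighbourFun [DecidableEq 𝔸] (π : G ≃g G) (S : Finset 𝔸) :
    funAtoms F (G ≃g G) 𝔸 π (commonNeighbourFun F G S) =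
      commonNeighbourFun F G (S.image (π • ·)) := by
  ext a
  have h : (∀ s ∈ S, G.Adj (π⁻¹ • a) s) ↔ ∀ s ∈ S.image (π • ·), G.Adj a s := by
    simp only [Finset.mem_image, forall_exists_index, and_imp, forall_apply_eq_imp_iff₂]
    refine forall₂_congr fun s _ => ?_
    rw [← π.map_adj_iff (v := π⁻¹ • a)]
    change G.Adj (π • π⁻¹ • a) (π • s) ↔ _
    rw [smul_inv_smul]
  change commonNeighbourFun F G S (π⁻¹ • a) = _
  classical
  simp only [commonNeighbourFun, Set.indicator_apply, Set.mem_ofPred_eq, h]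

/-- The space spanned by the functions `f_S`, where `S` ranges over the finite sets of atoms. -/
noncomputable def commonNeighbourSpan : Subrepresentation (funAtoms F (G ≃g G) 𝔸) where
  toSubmodule := Submodule.span F (Set.range (commonNeighbourFun F G))
  apply_mem_toSubmodule := by
    classical
    intro π f hf
    induction hf using Submodule.span_induction with
    | mem f hf =>
      obtain ⟨S, rfl⟩ := hf
      rw [funAtoms_commonNeighbourFun]
      exact Submodule.subset_span ⟨_, rfl⟩
    | zero => rw [map_zero]; exact Submodule.zero_mem _
    | add f g _ _ hf hg => rw [map_add]; exact Submodule.add_mem _ hf hg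
    | smul c f _ hf => rw [map_smul]; exact Submodule.smul_mem _ c hf

end Rado

end Atoms

/-! The negative claims rest on one counting obstruction. Supports in an orbit-finite set have size
at most some `k`, since an automorphism carries a support of a vector to a support of its image. Let
`S` have `k + 1` atoms and suppose `f_S` is a combination of finitely many elements with supports
`U` of size at most `k`. Let `T` be the union of `S` and these supports, and for `R ⊆ S` pick a
vertex `a R` outside `T` whose neighbours in `T` are exactly `R`. The functional `Λ f = ∑ (-1)^|R| f
(a R)` kills every such element: some `s ∈ S` is not in `U`, and homogeneity makes `f` agree at `a
R` and `a (R ∪ {s})`, so terms cancel in pairs. But only `R = S` contributes to `Λ f_S`, which is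
therefore `±1`, nonzero in every field.

`IsRadoGraph.exists_commonNeighbourFun_notMem` carries this out along an equivariant linear map `j`
into the functions on atoms, so that the same argument serves the dual, the function space and the
span of the `f_S`. -/

namespace Atoms

/-! ### Homogeneity and extension properties of the Rado graph -/

section Homogeneity

open Language

variable {𝔸 : Type u} [Countable 𝔸] {G : SimpleGraph 𝔸}

/-- The Rado graph is homogeneous: isomorphisms between finite induced subgraphs extend to
automorphisms. -/
theorem IsRadoGraph.exists_iso_extending (hG : IsRadoGraph G) (A : Set 𝔸) (hA : A.Finite)
    (φ : A → 𝔸) (hφ : Function.Injective φ) (hadj : ∀ x y, G.Adj (φ x) (φ y) ↔ G.Adj x.1 y.1) :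
    ∃ π : G ≃g G, ∀ x : A, π x = φ x := by
  let := G.structure
  have hu : Language.graph.IsUltrahomogeneous 𝔸 := hG.ultrahomogeneous
  -- The language is relational, so every vertex set is a substructure and a finite one generates
  -- itself.
  let A' : Language.graph.Substructure 𝔸 := ⟨A, fun f => isEmptyElim f⟩
  have hfg : A'.FG := by
    refine ⟨hA.toFinset, ?_⟩
    rw [hA.coe_toFinset]
    exact Substructure.closure_eq A'
  let f : A' ↪[Language.graph] 𝔸 := ⟨⟨φ, hφ⟩, fun F => isEmptyElim F, by
    intro n r x
    match n, r with
    | 2, .adj => exact hadj (x 0) (x 1)⟩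
  obtain ⟨g, hg⟩ := hu A' hfg f
  refine ⟨⟨g.toEquiv, fun {a b} => g.map_rel (Language.adj) ![a, b]⟩, fun x => ?_⟩
  exact (DFunLike.congr_fun hg x).symm

/-- Every finite graph embeds into the Rado graph. -/
theorem IsRadoGraph.exists_embedding (hG : IsRadoGraph G) {N : Type u} [Finite N]
    (H : SimpleGraph N) : Nonempty (H ↪g G) := by
  let := G.structure
  let := H.structure
  have hage : Language.graph.age 𝔸 = _ := hG.age
  have hmem : (CategoryTheory.Bundled.of N : CategoryTheory.Bundled Language.graph.Structure) ∈
      Language.graph.age 𝔸 := by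
    rw [hage]
    exact ⟨inferInstanceAs (Finite N), inferInstanceAs (N ⊨ Language.Theory.simpleGraph)⟩
  obtain ⟨e⟩ := hmem.2
  exact ⟨⟨e.toEmbedding, fun {a b} => e.map_rel (Language.adj) ![a, b]⟩⟩

/-- The extension property of the Rado graph. -/
theorem IsRadoGraph.exists_extension (hG : IsRadoGraph G) (T R : Finset 𝔸) :
    ∃ m, m ∉ T ∧ ∀ t ∈ T, G.Adj m t ↔ t ∈ R := by
  -- The graph induced on `T` with one new vertex `none`, joined to the elements of `R`.
  let H : SimpleGraph (Option T) :=
    { Adj := fun x y => match x, y with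
        | none, none => False
        | none, some t => t.1 ∈ R
        | some t, none => t.1 ∈ R
        | some s, some t => G.Adj s t
      symm := ⟨fun x y h => by
        match x, y with
        | none, none => exact h
        | none, some t => exact h
        | some t, none => exact h
        | some s, some t => exact G.adj_symm h⟩
      loopless := ⟨fun x h => by
        match x with
        | none => exact h
        | some s => exact G.loopless.irrefl _ h⟩ }
  obtain ⟨g⟩ := hG.exists_embedding H
  -- The embedding `g` may move `T`; `π` carries `T` to its copy, so `π.symm` brings the new vertex
  -- back to `T` itself.
  obtain ⟨π, hπ⟩ := hG.exists_iso_extending (T : Set 𝔸) T.finite_toSet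
    (fun t => g (some t)) (fun s t h => Option.some_injective _ (g.injective h))
    (fun s t => g.map_adj_iff)
  have hm : π (π.symm (g none)) = g none := π.apply_symm_apply _
  refine ⟨π.symm (g none), fun h => ?_, fun t ht => ?_⟩
  · have h1 := hπ ⟨_, h⟩
    rw [hm] at h1
    exact Option.some_ne_none _ (g.injective h1).symm
  · rw [← π.map_adj_iff, hm, hπ ⟨t, ht⟩, g.map_adj_iff]

/-- Vertices with the same neighbours in a finite set `T`, and lying outside of it, are in the same
orbit of the pointwise stabilizer of `T`. -/
theorem IsRadoGraph.exists_iso_fixing (hG : IsRadoGraph G) (T : Finset 𝔸) {a b : 𝔸} (ha : a ∉ T)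
    (hb : b ∉ T) (hab : ∀ t ∈ T, G.Adj a t ↔ G.Adj b t) :
    ∃ π : G ≃g G, (∀ t ∈ T, π • t = t) ∧ π • a = b := by
  classical
  have hne : ∀ x ∈ T, x ≠ a ∧ x ≠ b := fun x hx =>
    ⟨fun h => ha (h ▸ hx), fun h => hb (h ▸ hx)⟩
  -- The partial isomorphism sends `a` to `b` and is the identity on `T`.
  obtain ⟨π, hπ⟩ := hG.exists_iso_extending (insert a (T : Set 𝔸)) (T.finite_toSet.insert a)
    (fun x => if x.1 = a then b else x.1) (by
      rintro ⟨x, rfl | hx⟩ ⟨y, rfl | hy⟩ h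
      · rfl
      · simp only [if_true, (hne y hy).1, if_false] at h
        exact absurd h.symm (hne y hy).2
      · simp only [if_true, (hne x hx).1, if_false] at h
        exact absurd h (hne x hx).2
      · exact Subtype.ext (by simpa only [(hne x hx).1, (hne y hy).1, if_false] using h)) (by
      rintro ⟨x, rfl | hx⟩ ⟨y, rfl | hy⟩
      · simp
      · simpa only [if_true, (hne y hy).1, if_false] using (hab y hy).symm
      · simpa only [if_true, (hne x hx).1, if_false, G.adj_comm x] using (hab x hx).symm
      · simp only [(hne x hx).1, (hne y hy).1, if_false])
  refine ⟨π, fun t ht => ?_, ?_⟩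
  · exact (hπ ⟨t, Or.inr ht⟩).trans (if_neg (hne t ht).1)
  · exact (hπ ⟨a, Or.inl rfl⟩).trans (if_pos rfl)

theorem IsRadoGraph.infinite (hG : IsRadoGraph G) : Infinite 𝔸 :=
  Infinite.of_not_fintype fun _ => by
    obtain ⟨m, hm, -⟩ := hG.exists_extension Finset.univ ∅
    exact hm (Finset.mem_univ m)

end Homogeneity

/-! ### Bounded supports in orbit-finite sets -/

section OrbitFinite

variable {F Γ V 𝔸 : Type*} [Field F] [Group Γ] [MulAction Γ 𝔸] [AddCommMonoid V] [Module F V]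
  {ρ : Representation F Γ V}

/-- The vectors of an orbit-finite set have supports of bounded size. -/
theorem IsOrbitFinite.exists_card_support_le {X : Set V} (hX : IsOrbitFinite 𝔸 ρ X) :
    ∃ k : ℕ, ∀ x ∈ X, ∃ S : Finset 𝔸, S.card ≤ k ∧
      ∀ π : Γ, (∀ a ∈ S, π • a = a) → ρ π x = x := by
  classical
  -- The bound is stated for every set `O`, with a default for non-orbits, so that it can be chosen
  -- as a function of `O`.
  have horbit : ∀ O : Set V, ∃ k : ℕ, (∃ x ∈ X, O = Set.range fun π : Γ => ρ π x) →
      ∀ y ∈ O, ∃ S : Finset 𝔸, S.card ≤ k ∧ ∀ π : Γ, (∀ a ∈ S, π • a = a) → ρ π y = y := by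
    intro O
    by_cases hO : ∃ x ∈ X, O = Set.range fun π : Γ => ρ π x
    swap
    · exact ⟨0, fun h => absurd h hO⟩
    obtain ⟨x, hx, rfl⟩ := hO
    obtain ⟨S, hS⟩ := hX.supported x hx
    refine ⟨S.card, ?_⟩
    rintro - - ⟨g, rfl⟩
    refine ⟨S.image (g • ·), Finset.card_image_le, fun π h => ?_⟩
    have h1 : ρ (g⁻¹ * π * g) x = x := hS _ fun a ha => by
      rw [mul_smul, mul_smul, h (g • a) (Finset.mem_image_of_mem _ ha), inv_smul_smul]
    have h2 : π * g = g * (g⁻¹ * π * g) := by group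
    change ρ π (ρ g x) = ρ g x
    rw [← Module.End.mul_apply, ← map_mul, h2, map_mul, Module.End.mul_apply, h1]
  choose k hk using horbit
  obtain ⟨K, hK⟩ := (hX.finite_orbits.image k).bddAbove
  refine ⟨K, fun x hx => ?_⟩
  obtain ⟨S, hS, hS'⟩ := hk _ ⟨x, hx, rfl⟩ x ⟨1, by simp⟩
  exact ⟨S, hS.trans (hK ⟨_, ⟨x, hx, rfl⟩, rfl⟩), hS'⟩

end OrbitFinite

/-! ### The alternating-sum obstruction -/

section CommonNeighbours

variable {𝔸 : Type u} [Countable 𝔸] {G : SimpleGraph 𝔸} (F : Type v) [Field F]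

/-- The alternating sum, over the subsets `R` of `S`, of the values at vertices `a R` that have
exactly the neighbours `R` in a finite set `T`, vanishes on functions supported by a subset of `T`
that does not contain `S`. -/
theorem IsRadoGraph.alternating_sum_eq_zero (hG : IsRadoGraph G) [DecidableEq 𝔸] {S T U : Finset 𝔸}
    {a : Finset 𝔸 → 𝔸} (ha : ∀ R, a R ∉ T) (hadj : ∀ R, ∀ t ∈ T, G.Adj (a R) t ↔ t ∈ R)
    (hUT : U ⊆ T) (hSU : ¬ S ⊆ U) {f : 𝔸 → F}
    (hf : ∀ π : G ≃g G, (∀ t ∈ U, π • t = t) → funAtoms F (G ≃g G) 𝔸 π f = f) :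
    ∑ R ∈ S.powerset, (-1 : F) ^ R.card * f (a R) = 0 := by
  obtain ⟨s, hs, hsU⟩ := Finset.not_subset.1 hSU
  have hval : ∀ R, f (a (insert s R)) = f (a R) := by
    intro R
    obtain ⟨π, hπ, hπa⟩ := hG.exists_iso_fixing U (fun h => ha R (hUT h))
      (fun h => ha (insert s R) (hUT h)) (fun t ht => by
        rw [hadj _ _ (hUT ht), hadj _ _ (hUT ht), Finset.mem_insert, or_iff_right]
        rintro rfl
        exact hsU ht)
    have h : f (π⁻¹ • a (insert s R)) = f (a (insert s R)) := congr_fun (hf π hπ) _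
    rw [← h, ← hπa, inv_smul_smul]
  -- Pair each `R` not containing `s` with `insert s R`: equal values, opposite signs.
  rw [← Finset.insert_erase hs, Finset.sum_powerset_insert (Finset.notMem_erase s S),
    ← Finset.sum_add_distrib]
  refine Finset.sum_eq_zero fun R hR => ?_
  rw [hval, Finset.card_insert_of_notMem fun h =>
    Finset.notMem_erase s S (Finset.mem_powerset.1 hR h), pow_succ]
  ring

variable {V : Type*} [AddCommMonoid V] [Module F V]

/-- The span of an orbit-finite set does not contain all common-neighbour functions. -/
theorem IsRadoGraph.exists_commonNeighbourFun_notMem (hG : IsRadoGraph G)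
    {ρ : Representation F (G ≃g G) V} (j : V →ₗ[F] 𝔸 → F)
    (hj : ∀ π v, j (ρ π v) = funAtoms F (G ≃g G) 𝔸 π (j v)) {X : Set V}
    (hX : IsOrbitFinite 𝔸 ρ X) :
    ∃ S : Finset 𝔸, ∀ v ∈ Submodule.span F X, j v ≠ commonNeighbourFun F G S := by
  classical
  have := hG.infinite
  obtain ⟨k, hk⟩ := hX.exists_card_support_le
  choose! U hUcard hU using hk
  -- One atom more than the bound, so that no support contains `S`.
  obtain ⟨S, hS⟩ := Infinite.exists_subset_card_eq 𝔸 (k + 1)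
  refine ⟨S, fun v hv hvS => ?_⟩
  obtain ⟨Y, hYX, hvY⟩ := Submodule.mem_span_finite_of_mem_span hv
  -- The supports make `Λ` vanish on `Y`; `S` is included so that `f_S` can be evaluated at each `a
  -- R`.
  set T := S ∪ Y.biUnion U with hT
  choose a ha hadj using hG.exists_extension T
  let Λ : (𝔸 → F) →ₗ[F] F := ∑ R ∈ S.powerset, (-1 : F) ^ R.card • LinearMap.proj (a R)
  have hΛ : ∀ f, Λ f = ∑ R ∈ S.powerset, (-1 : F) ^ R.card * f (a R) := by
    intro f
    simp [Λ]
  have hzero : Submodule.span F (Y : Set V) ≤ LinearMap.ker (Λ ∘ₗ j) := by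
    refine Submodule.span_le.2 fun x hx => ?_
    rw [SetLike.mem_coe, LinearMap.mem_ker, LinearMap.comp_apply, hΛ]
    refine hG.alternating_sum_eq_zero F ha hadj (U := U x)
      ((Finset.subset_biUnion_of_mem U hx).trans Finset.subset_union_right) (fun h => ?_)
      fun π hπ => by rw [← hj, hU x (hYX hx) π hπ]
    have h1 := Finset.card_le_card h
    have h2 := hUcard x (hYX hx)
    omega
  have h0 : Λ (commonNeighbourFun F G S) = 0 := by
    rw [← hvS]
    exact hzero hvY
  have hval : ∀ R ∈ S.powerset, commonNeighbourFun F G S (a R) = if R = S then 1 else 0 := by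
    intro R hR
    rw [commonNeighbourFun, Set.indicator_apply]
    refine if_congr ?_ rfl rfl
    rw [Set.mem_ofPred_eq]
    refine ⟨fun h => (Finset.mem_powerset.1 hR).antisymm fun s hs =>
      (hadj R s (Finset.mem_union_left _ hs)).1 (h s hs), ?_⟩
    rintro rfl s hs
    exact (hadj R s (Finset.mem_union_left _ hs)).2 hs
  rw [hΛ, Finset.sum_congr rfl fun R hR => (by rw [hval R hR])] at h0
  simp at h0

/-- A space that maps equivariantly onto a space with all common-neighbour functions is not
orbit-finitely spanned. -/
theorem IsRadoGraph.not_isOrbitFinitelySpanned (hG : IsRadoGraph G)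
    {ρ : Representation F (G ≃g G) V} (j : V →ₗ[F] 𝔸 → F)
    (hj : ∀ π v, j (ρ π v) = funAtoms F (G ≃g G) 𝔸 π (j v))
    (hrange : ∀ S, ∃ v, j v = commonNeighbourFun F G S) : ¬ IsOrbitFinitelySpanned 𝔸 ρ := by
  rintro ⟨-, X, hX, hspan⟩
  obtain ⟨S, hS⟩ := hG.exists_commonNeighbourFun_notMem F j hj hX
  obtain ⟨v, hv⟩ := hrange S
  exact hS v (hspan ▸ Submodule.mem_top) hv

end CommonNeighbours

/-! ### Functionals on `Lin_F 𝔸` as functions on atoms -/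

section Functions

/-- The set `S` itself supports `f_S`. -/
theorem commonNeighbourSpan_le_fsFun (F : Type*) [Field F] {𝔸 : Type*} (G : SimpleGraph 𝔸) :
    commonNeighbourSpan F G ≤ fsFun F (G ≃g G) 𝔸 := by
  classical
  change Submodule.span F (Set.range (commonNeighbourFun F G)) ≤ (fsFun F (G ≃g G) 𝔸).toSubmodule
  rw [Submodule.span_le]
  rintro - ⟨S, rfl⟩
  refine ⟨S, fun π hπ => ?_⟩
  rw [funAtoms_commonNeighbourFun, Finset.image_congr (g := id) hπ, Finset.image_id]

variable (F Γ 𝔸 : Type*) [Field F] [Group Γ] [MulAction Γ 𝔸]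

/-- Linear functionals on `Lin_F 𝔸` are the same as functions on the atoms. -/
noncomputable def functionalEquivFun : ((𝔸 →₀ F) →ₗ[F] F) ≃ₗ[F] (𝔸 → F) :=
  (Finsupp.llift F F F 𝔸).symm

variable {F 𝔸} in
theorem functionalEquivFun_apply (f : (𝔸 →₀ F) →ₗ[F] F) (a : 𝔸) :
    functionalEquivFun F 𝔸 f a = f (Finsupp.single a 1) :=
  rfl

variable {F Γ 𝔸}

theorem functionalEquivFun_linHom (π : Γ) (f : (𝔸 →₀ F) →ₗ[F] F) :
    functionalEquivFun F 𝔸 (Representation.linHom (linAtoms F Γ 𝔸)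
        (Representation.trivial F Γ F) π f) =
      funAtoms F Γ 𝔸 π (functionalEquivFun F 𝔸 f) := by
  ext a
  change f (Finsupp.mapDomain _ (Finsupp.single a 1)) = f (Finsupp.single (π⁻¹ • a) 1)
  rw [Finsupp.mapDomain_single]

/-- An injective equivariant map preserves and reflects supports. -/
theorem functionalEquivFun_mem_iff (f : (𝔸 →₀ F) →ₗ[F] F) :
    functionalEquivFun F 𝔸 f ∈ (fsFun F Γ 𝔸).toSubmodule ↔
      f ∈ (fsDual 𝔸 (linAtoms F Γ 𝔸)).toSubmodule := by
  refine exists_congr fun S => forall_congr' fun π => imp_congr_right fun _ => ?_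
  rw [← functionalEquivFun_linHom, (functionalEquivFun F 𝔸).injective.eq_iff]

variable (F Γ 𝔸) in
/-- Restriction to the atoms, from finitely supported functionals on `Lin_F 𝔸` to finitely supported
functions on the atoms. -/
noncomputable def fsDualLinAtomsEquiv :
    (fsDual 𝔸 (linAtoms F Γ 𝔸)).toSubmodule ≃ₗ[F] (fsFun F Γ 𝔸).toSubmodule :=
  (functionalEquivFun F 𝔸).ofSubmodules _ _ <| by
    ext f
    rw [Submodule.mem_map_equiv, ← functionalEquivFun_mem_iff, LinearEquiv.apply_symm_apply]

theorem fsDualLinAtomsEquiv_toRepresentation (π : Γ) (f) :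
    fsDualLinAtomsEquiv F Γ 𝔸 ((fsDual 𝔸 (linAtoms F Γ 𝔸)).toRepresentation π f) =
      (fsFun F Γ 𝔸).toRepresentation π (fsDualLinAtomsEquiv F Γ 𝔸 f) :=
  Subtype.ext (functionalEquivFun_linHom π f.1)

theorem linAtoms_single (π : Γ) (a : 𝔸) (c : F) :
    linAtoms F Γ 𝔸 π (Finsupp.single a c) = Finsupp.single (π • a) c :=
  Finsupp.mapDomain_single

variable (F Γ 𝔸) in
/-- If the action on the atoms is transitive, then `Lin_F 𝔸` is spanned by a single orbit. -/
theorem isOrbitFinitelySpanned_linAtoms [MulAction.IsPretransitive Γ 𝔸] :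
    IsOrbitFinitelySpanned 𝔸 (linAtoms F Γ 𝔸) where
  supported v := by
    refine ⟨v.support, fun π hπ => ?_⟩
    change Finsupp.mapDomain _ v = v
    rw [Finsupp.mapDomain_congr (g := id) hπ, Finsupp.mapDomain_id]
  spanned := by
    refine ⟨Set.range fun a => Finsupp.single a 1, ⟨?_, ?_, ?_⟩, ?_⟩
    · rintro π - ⟨a, rfl⟩
      exact ⟨π • a, (linAtoms_single π a 1).symm⟩
    · rintro - ⟨a, rfl⟩
      refine ⟨{a}, fun π hπ => ?_⟩
      rw [linAtoms_single, hπ a (Finset.mem_singleton_self a)]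
    · refine (Set.finite_singleton (Set.range fun a : 𝔸 => Finsupp.single a (1 : F))).subset ?_
      rintro - ⟨-, ⟨a, rfl⟩, rfl⟩
      simp only [linAtoms_single]
      exact (MulAction.surjective_smul Γ a).range_comp fun b => Finsupp.single b (1 : F)
    · simpa using (Finsupp.basisSingleOne (R := F) (ι := 𝔸)).span_eq

end Functions

end Atoms

/-! ### Main theorem -/

open Atoms in
theorem mainTheorem12 {𝔸 : Type u} [Countable 𝔸] (G : SimpleGraph 𝔸) (hG : Atoms.IsRadoGraph G)
    (F : Type v) [Field F] :
    -- the finitely supported dual of `Lin_F 𝔸` is not orbit-finitely spanned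
    ¬ Atoms.IsOrbitFinitelySpanned 𝔸
        (Atoms.fsDual 𝔸 (Atoms.linAtoms F (G ≃g G) 𝔸)).toRepresentation ∧
    -- although `Lin_F 𝔸` is, so that the dual space property fails
    Atoms.IsOrbitFinitelySpanned 𝔸 (Atoms.linAtoms F (G ≃g G) 𝔸) ∧
    ¬ Atoms.DualSpaceProperty F (G ≃g G) 𝔸 ∧
    -- restriction to the atoms is an equivariant linear bijection from this dual onto the space of
    -- finitely supported functions `𝔸 → F`
    (∃ e : (Atoms.fsDual 𝔸 (Atoms.linAtoms F (G ≃g G) 𝔸)).toSubmodule ≃ₗ[F]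
          (Atoms.fsFun F (G ≃g G) 𝔸).toSubmodule,
      (∀ f a, (e f).1 a = f.1 (Finsupp.single a 1)) ∧
      ∀ (π : G ≃g G) f,
        e ((Atoms.fsDual 𝔸 (Atoms.linAtoms F (G ≃g G) 𝔸)).toRepresentation π f) =
          (Atoms.fsFun F (G ≃g G) 𝔸).toRepresentation π (e f)) ∧
    -- which is thus not orbit-finitely spanned either
    ¬ Atoms.IsOrbitFinitelySpanned 𝔸 (Atoms.fsFun F (G ≃g G) 𝔸).toRepresentation ∧
    -- the common-neighbour functions span an equivariant subspace of it
    Atoms.commonNeighbourSpan F G ≤ Atoms.fsFun F (G ≃g G) 𝔸 ∧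
    -- they do not form an orbit-finite set, and their span has no orbit-finite spanning set at all
    ¬ Atoms.IsOrbitFinite 𝔸 (Atoms.funAtoms F (G ≃g G) 𝔸)
        (Set.range (Atoms.commonNeighbourFun F G)) ∧
    ¬ Atoms.IsOrbitFinitelySpanned 𝔸 (Atoms.commonNeighbourSpan F G).toRepresentation := by
  have hfun : ¬ IsOrbitFinitelySpanned 𝔸 (fsFun F (G ≃g G) 𝔸).toRepresentation :=
    hG.not_isOrbitFinitelySpanned F (fsFun F (G ≃g G) 𝔸).toSubmodule.subtype (fun _ _ => rfl)
      fun S => ⟨⟨_, commonNeighbourSpan_le_fsFun F G (Submodule.subset_span ⟨S, rfl⟩)⟩, rfl⟩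
  have hdual : ¬ IsOrbitFinitelySpanned 𝔸
      (fsDual 𝔸 (linAtoms F (G ≃g G) 𝔸)).toRepresentation := by
    refine hG.not_isOrbitFinitelySpanned F ((fsFun F (G ≃g G) 𝔸).toSubmodule.subtype ∘ₗ
      (fsDualLinAtomsEquiv F (G ≃g G) 𝔸).toLinearMap)
      (fun π f => congr_arg Subtype.val (fsDualLinAtomsEquiv_toRepresentation π f)) fun S => ?_
    obtain ⟨f, hf⟩ := (fsDualLinAtomsEquiv F (G ≃g G) 𝔸).surjective
      ⟨_, commonNeighbourSpan_le_fsFun F G (Submodule.subset_span ⟨S, rfl⟩)⟩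
    exact ⟨f, congr_arg Subtype.val hf⟩
  -- Over the empty set all vertices have the same neighbours, so they form one orbit.
  have : MulAction.IsPretransitive (G ≃g G) 𝔸 := ⟨fun a b => by
    obtain ⟨π, -, hπ⟩ := hG.exists_iso_fixing ∅ (Finset.notMem_empty a) (Finset.notMem_empty b)
      (by simp)
    exact ⟨π, hπ⟩⟩
  have hlin := isOrbitFinitelySpanned_linAtoms F (G ≃g G) 𝔸
  refine ⟨hdual, hlin, fun h => hdual (h (𝔸 →₀ F) _ hlin), ⟨fsDualLinAtomsEquiv F (G ≃g G) 𝔸,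
    fun _ _ => rfl, fsDualLinAtomsEquiv_toRepresentation⟩, hfun, commonNeighbourSpan_le_fsFun F G,
    fun h => ?_, ?_⟩
  -- With `j` the identity, the span of all the `f_S` would have to miss one of them.
  · obtain ⟨S, hS⟩ := hG.exists_commonNeighbourFun_notMem F LinearMap.id (fun _ _ => rfl) h
    exact hS _ (Submodule.subset_span ⟨S, rfl⟩) rfl
  · exact hG.not_isOrbitFinitelySpanned F (commonNeighbourSpan F G).toSubmodule.subtype
      (fun _ _ => rfl) fun S => ⟨⟨_, Submodule.subset_span ⟨S, rfl⟩⟩, rfl⟩
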